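/- Let $n\ge 2$ and let $C\subset\mathbb R^n$ be a closed convex cone with nonempty interior that contains no line. Put $C^\circ=\{y\in\mathbb R^n:\langle x,y\rangle\le 0\text{ for all }x\in C\}$ and $\Omega=\operatorname{int}C^\circ\cap S^{n-1}$. Fix an orthonormal basis $e_1,\dots,e_n$ of $\mathbb R^n$ such that $u_*=-e_1\in\operatorname{int}C$ and, for some $\xi>0$, $\langle u,u_*\rangle>\xi$ for all $u\in C\cap S^{n-1}$ and $\langle v,u_*\rangle<-\xi$ for all $v\in C^\circ\cap S^{n-1}$. Write points of $\mathbb R^n$ as $(t,x)\in\mathbb R\times\mathbb R^{n-1}$ in these coordinates and let $\Phi:\mathbb R^{n-1}\to\{v\in S^{n-1}:\langle v,e_1\rangle>0\}$, $\Phi(x)=(1,x)/\sqrt{1+|x|^2}$, a bijection with inverse $\Phi^{-1}(v)=\langle v,e_1\rangle^{-1}(\langle v,e_2\rangle,\dots,\langle v,e_n\rangle)$. Here $\mathcal H^{n-1}$ is the $(n-1)$-dimensional Hausdorff measure, normalised to agree with Lebesgue measure on $\mathbb R^{n-1}$. Let $\mu$ be a locally finite Borel measure on $\Omega$, and for Borel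 $\Xi\subset\Phi^{-1}(\Omega)$ let $$\widetilde\mu(\Xi)=\int_{\Phi(\Xi)}|\langle v,e_1\rangle|\,d\mu(v).$$ Let $u:\overline{\Phi^{-1}(\Omega)}\to\mathbb R$ be continuous and convex, with $u=0$ on $\partial(\Phi^{-1}(\Omega))$ and $\mathcal M_u=\widetilde\mu$ on $\Phi^{-1}(\Omega)$, where $\mathcal M_u$ is the Monge–Ampère measure: for Borel $\Xi\subset\Phi^{-1}(\Omega)$, $$\mathcal M_u(\Xi)=\mathcal H^{n-1}\Big(\bigcup_{x\in\Xi}\partial u(x)\Big),\qquad \partial u(x)=\{p\in\mathbb R^{n-1}: u(z)\ge u(x)+\langle p,z-x\rangle\ \text{for all } z\in\Phi^{-1}(\Omega)\}.$$ Define $$K=\bigcap_{v\in\overline\Omega}\{z\in\mathbb R^n:\langle z,v\rangle\le\langle v,e_1\rangle\,u(\Phi^{-1}(v))\}.$$ Then $K$ is $C$-asymptotic, that is: - $K$ is nonempty, closed and convex, and $\lambda x\in K$ for all $x\in K$ and $\lambda\ge1$; - its recession cone $\{y\in\mathbb R^n: x+\lambda y\in K\text{ for all }x\in K,\ \lambda\ge1\}$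 equals $C$; - $\operatorname{dist}(x,\partial C)\to0$ as $|x|\to\infty$ with $x\in\partial K$. Moreover $S_K=\mu$ on $\Omega$, where, for every Borel $\eta\subset\Omega$, $$S_K(\eta)=\mathcal H^{n-1}\big(\{x\in\partial K:\langle x,v\rangle=h_K(v)\text{ for some }v\in\eta\}\big),\qquad h_K(v)=\sup_{x\in K}\langle x,v\rangle .$$ -/

import Mathlib

open Set Filter Topology MeasureTheory
open scoped RealInnerProductSpace ENNReal

noncomputable section

namespace PseudoCone

/-- Euclidean space `ℝ^d`. -/
abbrev Euc (d : ℕ) : Type := EuclideanSpace ℝ (Fin d)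

/-! ### Cones, duals and pseudo cones -/

/-- A closed convex cone with nonempty interior which is pointed, i.e. contains no full line. -/
structure IsSolidPointedCone {d : ℕ} (C : Set (Euc d)) : Prop where
  smul_mem : ∀ x ∈ C, ∀ r : ℝ, 0 ≤ r → r • x ∈ C
  isClosed : IsClosed C
  convex : Convex ℝ C
  interior_nonempty : (interior C).Nonempty
  no_line : ¬ ∃ x w : Euc d, w ≠ 0 ∧ ∀ t : ℝ, x + t • w ∈ C

/-- The dual (polar) cone `C° = {y : ⟨x, y⟩ ≤ 0 for all x ∈ C}`. -/
def dualCone {d : ℕ} (C : Set (Euc d)) : Set (Euc d) :=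
  {y | ∀ x ∈ C, ⟪x, y⟫ ≤ 0}

/-- `Ω = int C° ∩ S^{d-1}`. -/
def Omega {d : ℕ} (C : Set (Euc d)) : Set (Euc d) :=
  interior (dualCone C) ∩ Metric.sphere 0 1

/-- A nonempty closed convex set `K` with `λ K ⊆ K` for all `λ ≥ 1`. -/
structure IsPseudoCone {d : ℕ} (K : Set (Euc d)) : Prop where
  nonempty : K.Nonempty
  isClosed : IsClosed K
  convex : Convex ℝ K
  smul_mem : ∀ x ∈ K, ∀ r : ℝ, 1 ≤ r → r • x ∈ K

/-- The recession cone of `K`. -/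
def recCone {d : ℕ} (K : Set (Euc d)) : Set (Euc d) :=
  {y | ∀ x ∈ K, ∀ r : ℝ, 1 ≤ r → x + r • y ∈ K}

/-- `K` is `C`-pseudo: a pseudo cone whose recession cone is `C`. -/
def IsCPseudo {d : ℕ} (C K : Set (Euc d)) : Prop :=
  IsPseudoCone K ∧ recCone K = C

/-- `K` is `C`-asymptotic: it is `C`-pseudo, and `dist (x, ∂C) → 0` as `|x| → ∞`, `x ∈ ∂K`. -/
def IsCAsymptotic {d : ℕ} (C K : Set (Euc d)) : Prop :=
  IsCPseudo C K ∧
    Tendsto (fun x : Euc d => Metric.infDist x (frontier C))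
      (Bornology.cobounded (Euc d) ⊓ 𝓟 (frontier K)) (𝓝 0)

/-! ### Support function and surface area measure -/

/-- The support function `h_K(y) = sup_{x ∈ K} ⟨x, y⟩`. (For `C`-pseudo `K` and `y ∈ C°` the
supremum is over a nonempty set of nonpositive numbers.) -/
def supportFn {d : ℕ} (K : Set (Euc d)) (y : Euc d) : ℝ :=
  sSup ((fun x : Euc d => ⟪x, y⟫) '' K)

/-- The inverse Gauss image `τ_K(η)`: the boundary points of `K` having an outer normal in `η`. -/
def invGauss {d : ℕ} (K η : Set (Euc d)) : Set (Euc d) :=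
  {x | x ∈ frontier K ∧ ∃ v ∈ η, ⟪x, v⟫ = supportFn K v}

/-- The surface area measure `S_K(η) = H^{m}(τ_K(η))` of `K ⊆ ℝ^{m+1}`, for `η ⊆ Ω`.
`μHE[m]` is the `m`-dimensional Hausdorff measure, normalised as Lebesgue measure on `ℝ^m`. -/
def surfaceArea {m : ℕ} (C K : Set (Euc (m + 1))) (η : Set (Omega C)) : ℝ≥0∞ :=
  μHE[m] (invGauss K (Subtype.val '' η))

/-! ### Monge-Ampere measure -/

/-- The subdifferential at `x` of a function `u` considered on the set `Λ`. -/
def subdiff {m : ℕ} (Λ : Set (Euc m)) (u : Euc m → ℝ) (x : Euc m) : Set (Euc m) :=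
  {p | ∀ z ∈ Λ, u x + ⟪p, z - x⟫ ≤ u z}

/-- The Monge-Ampere measure `M_u(Ξ) = H^{m}(∂u(Ξ))` of `u : Λ → ℝ`, for `Ξ ⊆ Λ`. -/
def mongeAmpere {m : ℕ} (Λ : Set (Euc m)) (u : Euc m → ℝ) (Ξ : Set (Euc m)) : ℝ≥0∞ :=
  μHE[m] (⋃ x ∈ Ξ, subdiff Λ u x)

/-! ### The coordinate system and the projection of the hemisphere -/

/-- The requirements on the unit vector `w` (which is `-e₁` in the chosen coordinates):
`w ∈ int C`, `⟨u, w⟩ > ξ > 0` on `C ∩ S^{d-1}` and `⟨v, w⟩ < -ξ < 0` on `C° ∩ S^{d-1}`. -/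
def IsAxis {d : ℕ} (C : Set (Euc d)) (w : Euc d) : Prop :=
  w ∈ interior C ∧ ‖w‖ = 1 ∧
    ∃ ξ : ℝ, 0 < ξ ∧ (∀ u ∈ C, ‖u‖ = 1 → ξ < ⟪u, w⟫) ∧
      (∀ v ∈ dualCone C, ‖v‖ = 1 → ⟪v, w⟫ < -ξ)

/-- `Φ(x) = (1, x) / √(1 + |x|²)`, in the coordinates of the orthonormal basis `e`. Here
`e 0` is the first basis vector. -/
def Phi {m : ℕ} (e : OrthonormalBasis (Fin (m + 1)) ℝ (Euc (m + 1))) (x : Euc m) :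
    Euc (m + 1) :=
  (Real.sqrt (1 + ‖x‖ ^ 2))⁻¹ • (e 0 + ∑ i : Fin m, x i • e i.succ)

/-- `Φ⁻¹(v) = (⟨v, e₂⟩, …, ⟨v, eₙ⟩) / ⟨v, e₁⟩`, for `v` in the open hemisphere about `e₁`. -/
def PhiInv {m : ℕ} (e : OrthonormalBasis (Fin (m + 1)) ℝ (Euc (m + 1))) (v : Euc (m + 1)) :
    Euc m :=
  (⟪v, e 0⟫)⁻¹ • WithLp.toLp 2 (fun i : Fin m => ⟪v, e i.succ⟫)

/-- The domain `Φ⁻¹(Ω) ⊆ ℝ^m`. -/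
def domain {m : ℕ} (C : Set (Euc (m + 1)))
    (e : OrthonormalBasis (Fin (m + 1)) ℝ (Euc (m + 1))) : Set (Euc m) :=
  Phi e ⁻¹' Omega C

/-- The transported measure `μ̃(Ξ) = ∫_{Φ(Ξ)} |⟨v, e₁⟩| dμ(v)`, for `Ξ ⊆ Φ⁻¹(Ω)`. -/
def transported {m : ℕ} {C : Set (Euc (m + 1))}
    (e : OrthonormalBasis (Fin (m + 1)) ℝ (Euc (m + 1))) (μ : Measure (Omega C))
    (Ξ : Set (Euc m)) : ℝ≥0∞ :=
  ∫⁻ v in {v : Omega C | (v : Euc (m + 1)) ∈ Phi e '' Ξ},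
    ENNReal.ofReal |⟪(v : Euc (m + 1)), e 0⟫| ∂μ

/-- The set `K = ⋂_{v ∈ closure Ω} {z : ⟨z, v⟩ ≤ ⟨v, e₁⟩ u(Φ⁻¹(v))}`. -/
def wulffSet {m : ℕ} (C : Set (Euc (m + 1)))
    (e : OrthonormalBasis (Fin (m + 1)) ℝ (Euc (m + 1))) (u : Euc m → ℝ) :
    Set (Euc (m + 1)) :=
  ⋂ v ∈ closure (Omega C), {z | ⟪z, v⟫ ≤ ⟪v, e 0⟫ * u (PhiInv e v)}

end PseudoCone

end

noncomputable section

namespace PseudoCone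

/-! Write `D` for `domain C e` and `u*` for the Legendre conjugate of `u` over the compact set
`closure D`. In coordinates `(t, p)` the half-space with normal `Φ(x)` reads `t + ⟪p, x⟫ ≤ u x`, so
`K` is the region `t ≤ -u*(p)` and its boundary is the graph of `-u*`. For `u = 0` the same region
is `C`.

Asymptotics: `u ≤ 0` by convexity and the boundary values. Over a given `p`, the boundaries of `K`
and `C` differ in height by at most `-u x`, where `x` maximises `⟪p, ·⟫ - u`. For large `p` such an
`x` lies close to `∂D`, where `u` vanishes (`exists_neg_lt_of_conj_eq`).

Surface area: `Φ(x)` is normal to `K` above `p` exactly when `p ∈ ∂u(x)`, so the inverse Gauss image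
of `Φ(Ξ)` is the graph over `∂u(Ξ)` (`invGauss_wulffSet`). There `∇u* = x` wherever the gradient
exists, and the area element is `√(1 + |x|²)`. Hence `S_K` is `√(1 + |x|²) M_u` carried over by `Φ`,
and this factor cancels `⟪Φ(x), e₁⟫ = 1 / √(1 + |x|²)`, the density in the transported measure.

The last computation uses no area formula. Over the subgradients of a small set `Ξ` the graph is
nearly planar, so both measures agree on `Ξ` up to a factor near `1`; countable additivity
globalises this, and the factor is sent to `1` (`gradientArea_eq_map`). -/

/-- The Legendre conjugate of `u` considered on the set `Λ`. -/
def conj {m : ℕ} (Λ : Set (Euc m)) (u : Euc m → ℝ) (p : Euc m) : ℝ :=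
  sSup ((fun x => ⟪p, x⟫ - u x) '' Λ)

/-! ### Legendre conjugation over a compact set -/

section Conjugate

variable {m : ℕ} {Λ : Set (Euc m)} {u : Euc m → ℝ}

theorem inner_sub_le_conj (hΛ : IsCompact Λ) (hu : ContinuousOn u Λ) (p : Euc m) {x : Euc m}
    (hx : x ∈ Λ) : ⟪p, x⟫ - u x ≤ conj Λ u p := by
  refine le_csSup ?_ (mem_image_of_mem _ hx)
  exact (hΛ.image_of_continuousOn (by fun_prop)).bddAbove

theorem exists_conj_eq (hΛ : IsCompact Λ) (hne : Λ.Nonempty) (hu : ContinuousOn u Λ)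
    (p : Euc m) : ∃ x ∈ Λ, conj Λ u p = ⟪p, x⟫ - u x := by
  obtain ⟨x, hx, h⟩ := hΛ.exists_sSup_image_eq hne
    (show ContinuousOn (fun x => ⟪p, x⟫ - u x) Λ by fun_prop)
  exact ⟨x, hx, h⟩

theorem conj_le_iff (hΛ : IsCompact Λ) (hne : Λ.Nonempty) (hu : ContinuousOn u Λ)
    {p : Euc m} {a : ℝ} : conj Λ u p ≤ a ↔ ∀ x ∈ Λ, ⟪p, x⟫ - u x ≤ a := by
  refine ⟨fun h x hx => (inner_sub_le_conj hΛ hu p hx).trans h, fun h => ?_⟩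
  obtain ⟨x, hx, hpx⟩ := exists_conj_eq hΛ hne hu p
  exact hpx ▸ h x hx

/-- A maximiser at `p` gives an upper bound on the decrease of the conjugate. -/
theorem conj_sub_le (hΛ : IsCompact Λ) (hu : ContinuousOn u Λ) {p x : Euc m} (hx : x ∈ Λ)
    (hpx : conj Λ u p = ⟪p, x⟫ - u x) (q : Euc m) : conj Λ u p - conj Λ u q ≤ ⟪p - q, x⟫ := by
  have := inner_sub_le_conj hΛ hu q hx
  rw [inner_sub_left]
  linarith

theorem exists_lipschitzWith_conj (hΛ : IsCompact Λ) (hne : Λ.Nonempty) (hu : ContinuousOn u Λ) :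
    ∃ L, LipschitzWith L (conj Λ u) := by
  obtain ⟨R, hR⟩ := hΛ.isBounded.exists_norm_le
  refine ⟨R.toNNReal, LipschitzWith.of_le_add_mul _ fun p q => ?_⟩
  obtain ⟨x, hx, hpx⟩ := exists_conj_eq hΛ hne hu p
  have h1 := conj_sub_le hΛ hu hx hpx q
  have h2 := real_inner_le_norm (p - q) x
  have h3 : ‖p - q‖ * ‖x‖ ≤ R.toNNReal * ‖p - q‖ := by
    rw [mul_comm]
    gcongr
    exact (hR x hx).trans (Real.le_coe_toNNReal R)
  rw [dist_eq_norm]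
  linarith

theorem continuous_conj (hΛ : IsCompact Λ) (hne : Λ.Nonempty) (hu : ContinuousOn u Λ) :
    Continuous (conj Λ u) :=
  (exists_lipschitzWith_conj hΛ hne hu).choose_spec.continuous

/-- Where the conjugate is differentiable, its gradient is the only maximiser. -/
theorem gradient_conj_eq (hΛ : IsCompact Λ) (hu : ContinuousOn u Λ) {p x : Euc m} (hx : x ∈ Λ)
    (hpx : conj Λ u p = ⟪p, x⟫ - u x) (hd : DifferentiableAt ℝ (conj Λ u) p) :
    gradient (conj Λ u) p = x := by
  have hmin : IsLocalMin (fun q => conj Λ u q - ⟪x, q⟫) p := by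
    refine Eventually.of_forall fun q => ?_
    have := conj_sub_le hΛ hu hx hpx q
    rw [inner_sub_left] at this
    rw [real_inner_comm, real_inner_comm x] at this
    linarith
  have hder : HasFDerivAt (fun q => conj Λ u q - ⟪x, q⟫)
      (fderiv ℝ (conj Λ u) p - innerSL ℝ x) p :=
    hd.hasFDerivAt.sub (innerSL ℝ x).hasFDerivAt
  have h0 := hmin.hasFDerivAt_eq_zero hder
  rw [gradient, sub_eq_zero.1 h0]
  exact (InnerProductSpace.toDual ℝ (Euc m)).symm_apply_apply x

theorem measurable_gradient (f : Euc m → ℝ) : Measurable (gradient f) :=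
  (InnerProductSpace.toDual ℝ (Euc m)).symm.continuous.measurable.comp (measurable_fderiv ℝ f)

/-- The equality case of Young's inequality. Subgradients are tested on `D` only, the conjugate on
its closure; continuity of `u` bridges the two. -/
theorem mem_subdiff_iff {D : Set (Euc m)} (hΛ : IsCompact (closure D))
    (hu : ContinuousOn u (closure D)) {x p : Euc m} (hx : x ∈ D) :
    p ∈ subdiff D u x ↔ conj (closure D) u p = ⟪p, x⟫ - u x := by
  constructor
  · intro h
    refine le_antisymm ?_ (inner_sub_le_conj hΛ hu p (subset_closure hx))
    rw [conj_le_iff hΛ ⟨x, subset_closure hx⟩ hu]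
    intro z hz
    have hc : ContinuousOn (fun z => ⟪p, z⟫ - u z) (closure D) := by fun_prop
    have hs := hc.preimage_isClosed_of_isClosed isClosed_closure
      (isClosed_Iic (a := ⟪p, x⟫ - u x))
    have hsub : D ⊆ closure D ∩ (fun z => ⟪p, z⟫ - u z) ⁻¹' Iic (⟪p, x⟫ - u x) := by
      intro z hz
      have := h z hz
      rw [inner_sub_right] at this
      refine ⟨subset_closure hz, ?_⟩
      simp only [mem_preimage, mem_Iic]
      linarith
    exact (closure_minimal hsub hs hz).2
  · intro h z hz
    have := inner_sub_le_conj hΛ hu p (subset_closure hz)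
    rw [inner_sub_right]
    linarith

/-- A continuous convex function is the supremum of its affine minorants. -/
theorem exists_lt_inner_sub_conj (hΛ : IsCompact Λ) (hu : ContinuousOn u Λ) (hc : ConvexOn ℝ Λ u)
    {x : Euc m} (hx : x ∈ Λ) {a : ℝ} (ha : a < u x) : ∃ p, a ≤ ⟪p, x⟫ - conj Λ u p := by
  obtain ⟨l, c, hle, hl⟩ := ConvexOn.exists_affine_le_of_lt (𝕜 := ℝ) hx ha hΛ.isClosed
    hu.lowerSemicontinuousOn hc
  refine ⟨(InnerProductSpace.toDual ℝ (Euc m)).symm l, ?_⟩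
  have : conj Λ u ((InnerProductSpace.toDual ℝ (Euc m)).symm l) ≤ -c := by
    rw [conj_le_iff hΛ ⟨x, hx⟩ hu]
    intro z hz
    have := hle ⟨z, hz⟩
    simp at this
    simp
    linarith
  simp at hl ⊢
  linarith

/-- Otherwise `interior t` and the complement of `closure t` would separate `s`. -/
theorem _root_.IsPreconnected.inter_frontier_nonempty {X : Type*} [TopologicalSpace X]
    {s t : Set X} (hs : IsPreconnected s) (h1 : (s ∩ t).Nonempty) (h2 : (s ∩ tᶜ).Nonempty) :
    (s ∩ frontier t).Nonempty := by
  by_contra hne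
  have hfr : ∀ x ∈ s, x ∉ frontier t := fun x hx hxf => hne ⟨x, hx, hxf⟩
  have hint : ∀ x ∈ s, x ∈ closure t → x ∈ interior t := fun x hx hxc => by
    by_contra h
    exact hfr x hx ⟨hxc, h⟩
  obtain ⟨x, hx, hxi, hxc⟩ := hs (interior t) (closure t)ᶜ isOpen_interior
    isClosed_closure.isOpen_compl
    (fun x hx => or_iff_not_imp_right.2 fun h => hint x hx (not_not.1 h))
    (h1.imp fun x hx => ⟨hx.1, hint x hx.1 (subset_closure hx.2)⟩)
    (h2.imp fun x hx => ⟨hx.1, fun h => hx.2 (interior_subset (hint x hx.1 h))⟩)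
  exact hxc (interior_subset_closure hxi)

/-- A convex function vanishing on the boundary of a bounded domain is nonpositive. -/
theorem nonpos_of_frontier_eq_zero (hm : 1 ≤ m) {D : Set (Euc m)} (hD : Bornology.IsBounded D)
    (hc : ConvexOn ℝ (closure D) u) (h0 : ∀ x ∈ frontier D, u x = 0) :
    ∀ x ∈ closure D, u x ≤ 0 := by
  intro x hx
  by_cases hxD : x ∈ D
  swap
  · exact (h0 x ⟨hx, fun h => hxD (interior_subset h)⟩).le
  obtain ⟨R, hR⟩ := hD.exists_norm_le
  -- Every ray from `x` leaves the bounded set `D`. Two opposite rays, available since `1 ≤ m`, put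
  -- `x` on a segment whose endpoints are zeros of `u`.
  have key : ∀ h : Euc m, ‖h‖ = 1 → ∃ t : ℝ, 0 ≤ t ∧ x + t • h ∈ frontier D := by
    intro h hh
    have hpre : IsPreconnected ((fun t : ℝ => x + t • h) '' Ici 0) :=
      isPreconnected_Ici.image _ (by fun_prop)
    have h1 : ((fun t : ℝ => x + t • h) '' Ici 0 ∩ D).Nonempty :=
      ⟨x, ⟨0, by simp, by simp⟩, hxD⟩
    have h2 : ((fun t : ℝ => x + t • h) '' Ici 0 ∩ Dᶜ).Nonempty := by
      refine ⟨x + (|R| + ‖x‖ + 1) • h, ⟨_, ?_, rfl⟩, fun hmem => ?_⟩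
      · simp only [mem_Ici]; positivity
      · have h3 := hR _ hmem
        have h4 : ‖(|R| + ‖x‖ + 1) • h‖ = |R| + ‖x‖ + 1 := by
          rw [norm_smul, hh, mul_one, Real.norm_of_nonneg (by positivity)]
        have h5 := norm_sub_le (x + (|R| + ‖x‖ + 1) • h) x
        rw [add_sub_cancel_left, h4] at h5
        linarith [le_abs_self R]
    obtain ⟨_, ⟨t, ht, rfl⟩, hf⟩ := hpre.inter_frontier_nonempty h1 h2
    exact ⟨t, ht, hf⟩
  have h1 : ‖(EuclideanSpace.single ⟨0, hm⟩ 1 : Euc m)‖ = 1 := by simp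
  obtain ⟨s, hs, hsf⟩ := key _ h1
  obtain ⟨t, ht, htf⟩ := key (-EuclideanSpace.single ⟨0, hm⟩ 1) (by simp)
  set h : Euc m := EuclideanSpace.single ⟨0, hm⟩ 1
  have hseg : x ∈ segment ℝ (x + s • h) (x + t • -h) := by
    rcases eq_or_lt_of_le (add_nonneg hs ht) with hst | hst
    · have : s = 0 := by linarith
      subst this
      simpa using left_mem_segment ℝ x _
    · refine ⟨t / (s + t), s / (s + t), by positivity, by positivity, by field_simp; ring, ?_⟩
      have h1 : t / (s + t) + s / (s + t) = 1 := by field_simp; ring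
      have h2 : t / (s + t) * s = s / (s + t) * t := by ring
      rw [smul_add, smul_add, add_add_add_comm, ← add_smul, h1, one_smul, smul_neg, smul_neg,
        smul_smul, smul_smul, h2, add_neg_cancel, add_zero]
  have := hc.le_max_of_mem_segment (frontier_subset_closure hsf) (frontier_subset_closure htf) hseg
  rwa [h0 _ hsf, h0 _ htf, max_self] at this

end Conjugate

/-! ### Coordinates `(t, x)` and the central projection `Φ` -/

section Coordinates

variable {m : ℕ} (e : OrthonormalBasis (Fin (m + 1)) ℝ (Euc (m + 1)))

/-- The point with coordinates `(t, x)` with respect to the basis `e`. -/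
def pt (t : ℝ) (x : Euc m) : Euc (m + 1) := t • e 0 + ∑ i : Fin m, x i • e i.succ

/-- The last `m` coordinates of a point with respect to the basis `e`. -/
def tail (z : Euc (m + 1)) : Euc m := WithLp.toLp 2 (fun i : Fin m => ⟪z, e i.succ⟫)

theorem pt_sub (t s : ℝ) (x y : Euc m) : pt e t x - pt e s y = pt e (t - s) (x - y) := by
  simp only [pt, sub_smul, PiLp.sub_apply, Finset.sum_sub_distrib]
  abel

theorem pt_add (t s : ℝ) (x y : Euc m) : pt e t x + pt e s y = pt e (t + s) (x + y) := by
  simp only [pt, add_smul, PiLp.add_apply, Finset.sum_add_distrib]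
  abel

theorem smul_pt (c t : ℝ) (x : Euc m) : c • pt e t x = pt e (c * t) (c • x) := by
  simp only [pt, smul_add, Finset.smul_sum, smul_smul, PiLp.smul_apply, smul_eq_mul]

theorem pt_tail (z : Euc (m + 1)) : pt e ⟪z, e 0⟫ (tail e z) = z := by
  conv_rhs => rw [← e.sum_repr' z, Fin.sum_univ_succ]
  simp [pt, tail, real_inner_comm]

theorem inner_pt_left (t : ℝ) (x : Euc m) (z : Euc (m + 1)) :
    ⟪pt e t x, z⟫ = t * ⟪z, e 0⟫ + ⟪x, tail e z⟫ := by
  simp [pt, tail, inner_add_left, sum_inner, inner_smul_left, PiLp.inner_apply, mul_comm]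

@[simp]
theorem inner_pt_zero (t : ℝ) (x : Euc m) : ⟪pt e t x, e 0⟫ = t := by
  have h : ∀ i : Fin m, ⟪e 0, e i.succ⟫ = 0 := fun i =>
    e.orthonormal.2 (Fin.succ_ne_zero i).symm
  have h0 : tail e (e 0) = 0 := by ext i; simp [tail, h]
  rw [inner_pt_left, h0]
  simp

@[simp]
theorem tail_pt (t : ℝ) (x : Euc m) : tail e (pt e t x) = x := by
  ext i
  have h : ⟪e 0, e i.succ⟫ = 0 := e.orthonormal.2 (Fin.succ_ne_zero i).symm
  have h1 : tail e (e i.succ) = EuclideanSpace.single i 1 := by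
    ext j
    simp [tail, e.inner_eq_ite, eq_comm]
  have h2 : ⟪pt e t x, e i.succ⟫ = x i := by
    rw [inner_pt_left, h1, real_inner_comm, h]
    simp [EuclideanSpace.inner_single_right]
  exact h2

theorem inner_pt_pt (t s : ℝ) (x y : Euc m) : ⟪pt e t x, pt e s y⟫ = t * s + ⟪x, y⟫ := by
  rw [inner_pt_left, inner_pt_zero, tail_pt]

theorem norm_pt_sq (t : ℝ) (x : Euc m) : ‖pt e t x‖ ^ 2 = t ^ 2 + ‖x‖ ^ 2 := by
  rw [← real_inner_self_eq_norm_sq, inner_pt_pt, real_inner_self_eq_norm_sq]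
  ring

theorem norm_pt (t : ℝ) (x : Euc m) : ‖pt e t x‖ = √(t ^ 2 + ‖x‖ ^ 2) := by
  rw [← norm_pt_sq, Real.sqrt_sq (norm_nonneg _)]

theorem norm_pt_zero_right (t : ℝ) : ‖pt e t 0‖ = |t| := by
  rw [norm_pt]
  simp [Real.sqrt_sq_eq_abs]

theorem norm_le_abs_add_norm_tail (z : Euc (m + 1)) : ‖z‖ ≤ |⟪z, e 0⟫| + ‖tail e z‖ := by
  rw [← abs_of_nonneg (norm_nonneg z),
    ← abs_of_nonneg (show 0 ≤ |⟪z, e 0⟫| + ‖tail e z‖ by positivity), ← sq_le_sq]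
  conv_lhs => rw [← pt_tail e z, norm_pt_sq]
  nlinarith [sq_abs ⟪z, e 0⟫, abs_nonneg ⟪z, e 0⟫, norm_nonneg (tail e z),
    mul_nonneg (abs_nonneg ⟪z, e 0⟫) (norm_nonneg (tail e z))]

@[fun_prop]
theorem continuous_pt {X : Type*} [TopologicalSpace X] {f : X → ℝ} {g : X → Euc m}
    (hf : Continuous f) (hg : Continuous g) : Continuous fun a => pt e (f a) (g a) := by
  unfold pt
  fun_prop

@[fun_prop]
theorem continuous_tail : Continuous (tail e) := by
  unfold tail
  fun_prop

theorem Phi_eq (x : Euc m) : Phi e x = (√(1 + ‖x‖ ^ 2))⁻¹ • pt e 1 x := by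
  rw [Phi, pt, one_smul]

theorem PhiInv_eq (v : Euc (m + 1)) : PhiInv e v = (⟪v, e 0⟫)⁻¹ • tail e v := rfl

theorem sqrt_one_add_pos (x : Euc m) : 0 < √(1 + ‖x‖ ^ 2) := by positivity

theorem continuous_Phi : Continuous (Phi e) := by
  have h : ∀ x : Euc m, √(1 + ‖x‖ ^ 2) ≠ 0 := fun x => (sqrt_one_add_pos x).ne'
  simp only [funext (Phi_eq e)]
  fun_prop (disch := exact h _)

theorem inner_Phi_zero (x : Euc m) : ⟪Phi e x, e 0⟫ = (√(1 + ‖x‖ ^ 2))⁻¹ := by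
  rw [Phi_eq, inner_smul_left, inner_pt_zero]
  simp

theorem inner_pt_Phi (t : ℝ) (p x : Euc m) :
    ⟪pt e t p, Phi e x⟫ = (√(1 + ‖x‖ ^ 2))⁻¹ * (t + ⟪p, x⟫) := by
  rw [Phi_eq, inner_smul_right, inner_pt_pt, mul_one]

theorem norm_Phi (x : Euc m) : ‖Phi e x‖ = 1 := by
  rw [Phi_eq, norm_smul, norm_pt, one_pow, norm_inv, Real.norm_of_nonneg (Real.sqrt_nonneg _),
    inv_mul_cancel₀ (sqrt_one_add_pos x).ne']

theorem PhiInv_Phi (x : Euc m) : PhiInv e (Phi e x) = x := by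
  have h : tail e (Phi e x) = (√(1 + ‖x‖ ^ 2))⁻¹ • x := by
    rw [Phi_eq, smul_pt, tail_pt]
  rw [PhiInv_eq, inner_Phi_zero, h, smul_smul, inv_inv, mul_inv_cancel₀ (sqrt_one_add_pos x).ne',
    one_smul]

theorem Phi_PhiInv {v : Euc (m + 1)} (hv : ‖v‖ = 1) (h0 : 0 < ⟪v, e 0⟫) :
    Phi e (PhiInv e v) = v := by
  have h1 : ⟪v, e 0⟫ ^ 2 + ‖tail e v‖ ^ 2 = 1 := by
    rw [← norm_pt_sq, pt_tail, hv, one_pow]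
  have h2 : 1 + ‖(⟪v, e 0⟫)⁻¹ • tail e v‖ ^ 2 = (⟪v, e 0⟫⁻¹) ^ 2 := by
    rw [norm_smul, mul_pow, norm_inv, Real.norm_of_nonneg h0.le]
    field_simp
    exact h1
  rw [Phi_eq, PhiInv_eq, h2, Real.sqrt_sq (by positivity), inv_inv, smul_pt, smul_smul, mul_one,
    mul_inv_cancel₀ h0.ne', one_smul, pt_tail]

theorem continuousAt_PhiInv {v : Euc (m + 1)} (h0 : ⟪v, e 0⟫ ≠ 0) :
    ContinuousAt (PhiInv e) v := by
  unfold PhiInv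
  fun_prop (disch := assumption)

end Coordinates

/-! ### The dual cone, and `K` as the region under the graph of `-u*` -/

section Cone

variable {m : ℕ} {C : Set (Euc (m + 1))} {e : OrthonormalBasis (Fin (m + 1)) ℝ (Euc (m + 1))}

theorem smul_mem_dualCone {d : ℕ} {C : Set (Euc d)} {y : Euc d} (hy : y ∈ dualCone C) {r : ℝ}
    (hr : 0 ≤ r) : r • y ∈ dualCone C := fun x hx => by
  rw [inner_smul_right]
  exact mul_nonpos_of_nonneg_of_nonpos hr (hy x hx)

theorem smul_mem_interior_dualCone {d : ℕ} {C : Set (Euc d)} {y : Euc d}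
    (hy : y ∈ interior (dualCone C)) {r : ℝ} (hr : 0 < r) : r • y ∈ interior (dualCone C) := by
  have h : r⁻¹ • (r • y) ∈ interior (dualCone C) := by rwa [inv_smul_smul₀ hr.ne']
  have hp : IsOpen ((fun z : Euc d => r⁻¹ • z) ⁻¹' interior (dualCone C)) :=
    isOpen_interior.preimage (by fun_prop)
  refine interior_maximal (fun z hz => ?_) hp h
  have := smul_mem_dualCone (interior_subset hz) hr.le
  rwa [smul_inv_smul₀ hr.ne'] at this

theorem IsSolidPointedCone.zero_mem {d : ℕ} {C : Set (Euc d)} (hC : IsSolidPointedCone C) :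
    (0 : Euc d) ∈ C := by
  obtain ⟨x, hx⟩ := hC.interior_nonempty
  simpa using hC.smul_mem x (interior_subset hx) 0 le_rfl

/-- The bipolar theorem for closed convex cones. -/
theorem IsSolidPointedCone.exists_inner_pos {d : ℕ} {C : Set (Euc d)} (hC : IsSolidPointedCone C)
    {z : Euc d} (hz : z ∉ C) : ∃ y ∈ dualCone C, 0 < ⟪z, y⟫ := by
  obtain ⟨f, a, hfa, haz⟩ := geometric_hahn_banach_closed_point hC.convex hC.isClosed hz
  have ha : 0 < a := by simpa using hfa 0 hC.zero_mem
  have hf : ∀ x, ⟪x, (InnerProductSpace.toDual ℝ (Euc d)).symm f⟫ = f x := fun x => by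
    rw [real_inner_comm]; simp
  refine ⟨(InnerProductSpace.toDual ℝ (Euc d)).symm f, fun x hx => ?_, ?_⟩
  · rw [hf]
    by_contra! hpos
    -- This multiple of `x` lies in `C` and has `f`-value exactly `a`.
    have := hfa _ (hC.smul_mem x hx (a / f x) (by positivity))
    rw [map_smul, smul_eq_mul, div_mul_cancel₀ _ hpos.ne'] at this
    exact this.false
  · rw [hf]
    exact ha.trans haz

theorem add_smul_mem_interior_dualCone (hC : IsSolidPointedCone C)
    (he : IsAxis C (-e 0)) {y : Euc (m + 1)}
    (hy : y ∈ dualCone C) {ε : ℝ} (hε : 0 < ε) : y + ε • e 0 ∈ interior (dualCone C) := by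
  obtain ⟨-, -, ξ, hξ, hCξ, -⟩ := he
  rw [mem_interior]
  -- On `C` one has `⟪x, e 0⟫ ≤ -ξ ‖x‖`, so the shift by `ε • e 0` absorbs any perturbation of norm
  -- below `ε * ξ`.
  refine ⟨Metric.ball (y + ε • e 0) (ε * ξ), fun w hw x hx => ?_, Metric.isOpen_ball,
    Metric.mem_ball_self (by positivity)⟩
  rcases eq_or_ne x 0 with rfl | hx0
  · simp
  rw [mem_ball_iff_norm] at hw
  have h2 : ⟪x, e 0⟫ ≤ -ξ * ‖x‖ := by
    have hn : 0 < ‖x‖ := norm_pos_iff.2 hx0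
    have := hCξ (‖x‖⁻¹ • x) (hC.smul_mem x hx _ (by positivity))
      (by rw [norm_smul, norm_inv, norm_norm, inv_mul_cancel₀ hn.ne'])
    rw [inner_smul_left, inner_neg_right] at this
    simp only [conj_trivial] at this
    have h := mul_lt_mul_of_pos_left this hn
    rw [← mul_assoc, mul_inv_cancel₀ hn.ne'] at h
    linarith
  have h3 := real_inner_le_norm x (w - (y + ε • e 0))
  have h4 : ‖x‖ * ‖w - (y + ε • e 0)‖ ≤ ‖x‖ * (ε * ξ) := by gcongr
  have h5 := hy x hx
  have h6 : ⟪x, w⟫ = ⟪x, y⟫ + ε * ⟪x, e 0⟫ + ⟪x, w - (y + ε • e 0)⟫ := by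
    rw [inner_sub_right, inner_add_right, inner_smul_right]; ring
  nlinarith

theorem IsAxis.exists_lt_inner (he : IsAxis C (-e 0)) :
    ∃ ξ : ℝ, 0 < ξ ∧ ∀ v ∈ dualCone C, ‖v‖ = 1 → ξ < ⟪v, e 0⟫ := by
  obtain ⟨-, -, ξ, hξ, -, h⟩ := he
  refine ⟨ξ, hξ, fun v hv hv1 => ?_⟩
  have := h v hv hv1
  rw [inner_neg_right] at this
  linarith

theorem inner_zero_pos_of_mem_dualCone (he : IsAxis C (-e 0)) {v : Euc (m + 1)}
    (hv : v ∈ dualCone C) (hv1 : ‖v‖ = 1) : 0 < ⟪v, e 0⟫ := by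
  obtain ⟨ξ, hξ, h⟩ := he.exists_lt_inner
  exact hξ.trans (h v hv hv1)

theorem Omega_subset : Omega C ⊆ dualCone C ∩ Metric.sphere 0 1 :=
  inter_subset_inter_left _ interior_subset

theorem isClosed_dualCone {d : ℕ} (C : Set (Euc d)) : IsClosed (dualCone C) := by
  have : dualCone C = ⋂ x ∈ C, {y | ⟪x, y⟫ ≤ 0} := by ext; simp [dualCone]
  rw [this]
  exact isClosed_biInter fun x _ => isClosed_le (by fun_prop) continuous_const

theorem closure_Omega_subset : closure (Omega C) ⊆ dualCone C ∩ Metric.sphere 0 1 :=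
  closure_minimal Omega_subset ((isClosed_dualCone C).inter Metric.isClosed_sphere)

theorem mem_domain_iff {x : Euc m} : x ∈ domain C e ↔ pt e 1 x ∈ interior (dualCone C) := by
  have h : x ∈ domain C e ↔ Phi e x ∈ interior (dualCone C) := by
    simp [domain, Omega, norm_Phi]
  rw [h, Phi_eq]
  refine ⟨fun h => ?_, fun h => smul_mem_interior_dualCone h (by positivity)⟩
  have := smul_mem_interior_dualCone h (sqrt_one_add_pos x)
  rwa [smul_inv_smul₀ (sqrt_one_add_pos x).ne'] at this

theorem isBounded_domain (he : IsAxis C (-e 0)) : Bornology.IsBounded (domain C e) := by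
  obtain ⟨ξ, hξ, h⟩ := he.exists_lt_inner
  refine (isBounded_iff_forall_norm_le).2 ⟨ξ⁻¹, fun x hx => ?_⟩
  have := h _ (interior_subset hx.1) (norm_Phi e x)
  rw [inner_Phi_zero] at this
  have h2 := (lt_inv_comm₀ hξ (sqrt_one_add_pos x)).1 this
  refine le_trans ?_ h2.le
  exact Real.le_sqrt_of_sq_le (by linarith)

theorem isCompact_closure_domain (he : IsAxis C (-e 0)) : IsCompact (closure (domain C e)) :=
  (isBounded_domain he).isCompact_closure

theorem zero_mem_domain (hC : IsSolidPointedCone C) (he : IsAxis C (-e 0)) :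
    (0 : Euc m) ∈ domain C e := by
  have h0 : (0 : Euc (m + 1)) ∈ dualCone C := fun x _ => by simp
  have := add_smul_mem_interior_dualCone hC he h0 one_pos
  rw [mem_domain_iff]
  simpa [pt] using this

theorem Phi_mem_closure_Omega {x : Euc m} (hx : x ∈ closure (domain C e)) :
    Phi e x ∈ closure (Omega C) :=
  map_mem_closure (continuous_Phi e) hx fun _ h => h

theorem PhiInv_mem_domain (he : IsAxis C (-e 0)) {v : Euc (m + 1)} (hv : v ∈ Omega C) :
    PhiInv e v ∈ domain C e := by
  have h1 : ‖v‖ = 1 := by simpa using hv.2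
  rw [domain, mem_preimage,
    Phi_PhiInv e h1 (inner_zero_pos_of_mem_dualCone he (interior_subset hv.1) h1)]
  exact hv

theorem exists_eq_Phi_of_mem_closure_Omega (he : IsAxis C (-e 0)) {v : Euc (m + 1)}
    (hv : v ∈ closure (Omega C)) : ∃ x ∈ closure (domain C e), v = Phi e x := by
  have h1 : ‖v‖ = 1 := by simpa using (closure_Omega_subset hv).2
  have h0 := inner_zero_pos_of_mem_dualCone he (closure_Omega_subset hv).1 h1
  refine ⟨PhiInv e v, ?_, (Phi_PhiInv e h1 h0).symm⟩
  refine closure_mono ?_ (mem_closure_image (continuousAt_PhiInv e h0.ne') hv)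
  rintro _ ⟨w, hw, rfl⟩
  exact PhiInv_mem_domain he hw

variable {u : Euc m → ℝ}

theorem pt_mem_wulffSet_iff (he : IsAxis C (-e 0)) {t : ℝ} {p : Euc m} :
    pt e t p ∈ wulffSet C e u ↔ ∀ x ∈ closure (domain C e), t + ⟪p, x⟫ ≤ u x := by
  have key : ∀ x : Euc m, ⟪pt e t p, Phi e x⟫ ≤ ⟪Phi e x, e 0⟫ * u (PhiInv e (Phi e x)) ↔
      t + ⟪p, x⟫ ≤ u x := fun x => by
    rw [inner_pt_Phi, inner_Phi_zero, PhiInv_Phi]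
    exact mul_le_mul_iff_right₀ (inv_pos.2 (sqrt_one_add_pos x))
  simp only [wulffSet, mem_iInter, mem_ofPred_eq]
  constructor
  · exact fun h x hx => (key x).1 (h _ (Phi_mem_closure_Omega hx))
  · intro h v hv
    obtain ⟨x, hx, rfl⟩ := exists_eq_Phi_of_mem_closure_Omega he hv
    exact (key x).2 (h x hx)

theorem mem_wulffSet_iff_tail (he : IsAxis C (-e 0)) {z : Euc (m + 1)} :
    z ∈ wulffSet C e u ↔ ∀ x ∈ closure (domain C e), ⟪z, e 0⟫ + ⟪tail e z, x⟫ ≤ u x := by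
  rw [← pt_mem_wulffSet_iff he, pt_tail]

/-- The bipolar theorem, with a separating `y ∈ C°` first pushed into the interior along `e 0` and
then normalised, so that normals in `Ω` suffice. -/
theorem wulffSet_zero (hC : IsSolidPointedCone C) (he : IsAxis C (-e 0)) :
    wulffSet C e 0 = C := by
  ext z
  have hz : z ∈ wulffSet C e 0 ↔ ∀ v ∈ closure (Omega C), ⟪z, v⟫ ≤ 0 := by simp [wulffSet]
  rw [hz]
  refine ⟨fun h => ?_, fun h v hv => (closure_Omega_subset hv).1 z h⟩
  by_contra hzC
  obtain ⟨y, hy, hzy⟩ := hC.exists_inner_pos hzC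
  have hcont : Tendsto (fun ε : ℝ => ⟪z, y + ε • e 0⟫) (𝓝[>] 0) (𝓝 ⟪z, y⟫) := by
    have : Continuous fun ε : ℝ => ⟪z, y + ε • e 0⟫ := by fun_prop
    simpa using (this.tendsto 0).mono_left nhdsWithin_le_nhds
  obtain ⟨ε, hε, hε0⟩ := ((hcont.eventually (lt_mem_nhds hzy)).and self_mem_nhdsWithin).exists
  have hmem := add_smul_mem_interior_dualCone hC he hy hε0
  set w := y + ε • e 0
  have hw : 0 < ‖w‖ := by
    rw [norm_pos_iff]
    rintro h0
    simp [h0] at hε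
  have := h (‖w‖⁻¹ • w) (subset_closure ⟨smul_mem_interior_dualCone hmem (by positivity), by
    simp [norm_smul, hw.ne']⟩)
  rw [inner_smul_right] at this
  have : 0 < ‖w‖⁻¹ * ⟪z, w⟫ := by positivity
  linarith

theorem mem_wulffSet_iff (hC : IsSolidPointedCone C) (he : IsAxis C (-e 0))
    (hu : ContinuousOn u (closure (domain C e)))
    {z : Euc (m + 1)} :
    z ∈ wulffSet C e u ↔ ⟪z, e 0⟫ ≤ -conj (closure (domain C e)) u (tail e z) := by
  rw [mem_wulffSet_iff_tail he, le_neg, conj_le_iff (isCompact_closure_domain he)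
    ⟨0, subset_closure (zero_mem_domain hC he)⟩ hu]
  refine forall₂_congr fun x _ => ?_
  constructor <;> intro <;> linarith

theorem isClosed_wulffSet : IsClosed (wulffSet C e u) := by
  simp only [wulffSet]
  exact isClosed_biInter fun v _ => isClosed_le (by fun_prop) continuous_const

theorem mem_frontier_wulffSet_iff (hC : IsSolidPointedCone C) (he : IsAxis C (-e 0))
    (hu : ContinuousOn u (closure (domain C e)))
    {z : Euc (m + 1)} :
    z ∈ frontier (wulffSet C e u) ↔
      ⟪z, e 0⟫ = -conj (closure (domain C e)) u (tail e z) := by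
  have hc := continuous_conj (isCompact_closure_domain he)
    ⟨0, subset_closure (zero_mem_domain hC he)⟩ hu
  have hK : wulffSet C e u =
      {z | ⟪z, e 0⟫ ≤ -conj (closure (domain C e)) u (tail e z)} := by
    ext z
    exact mem_wulffSet_iff hC he hu
  constructor
  · intro hz
    rw [hK] at hz
    exact frontier_le_subset_eq (by fun_prop) (hc.comp (continuous_tail e)).neg hz
  · intro hz
    refine ⟨subset_closure ((mem_wulffSet_iff hC he hu).2 hz.le), fun hi => ?_⟩
    -- A point of the graph is not interior, since raising it along `e 0` leaves `K`.
    have hcont : Tendsto (fun ε : ℝ => z + pt e ε 0) (𝓝[>] 0) (𝓝 z) := by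
      have : Continuous fun ε : ℝ => z + pt e ε 0 := by fun_prop
      simpa [pt] using (this.tendsto 0).mono_left nhdsWithin_le_nhds
    obtain ⟨ε, hε, hε0⟩ := ((hcont.eventually (mem_interior_iff_mem_nhds.1 hi)).and
      self_mem_nhdsWithin).exists
    have h1 : z + pt e ε 0 = pt e (⟪z, e 0⟫ + ε) (tail e z) := by
      conv_lhs => rw [← pt_tail e z, pt_add, add_zero]
    have hmem : z + pt e ε 0 ∈ wulffSet C e u := hε
    rw [h1, mem_wulffSet_iff hC he hu, inner_pt_zero, tail_pt] at hmem
    have : (0 : ℝ) < ε := hε0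
    linarith

end Cone

/-! ### Recession cone and asymptotic behaviour -/

section Asymptotic

variable {m : ℕ} {C : Set (Euc (m + 1))} {e : OrthonormalBasis (Fin (m + 1)) ℝ (Euc (m + 1))}
  {u : Euc m → ℝ}

theorem isCPseudo_wulffSet (hC : IsSolidPointedCone C) (he : IsAxis C (-e 0))
    (hu : ContinuousOn u (closure (domain C e))) (hu0 : ∀ x ∈ closure (domain C e), u x ≤ 0) :
    IsCPseudo C (wulffSet C e u) := by
  have hmem : ∀ z, z ∈ wulffSet C e u ↔
      ∀ v ∈ closure (Omega C), ⟪z, v⟫ ≤ ⟪v, e 0⟫ * u (PhiInv e v) := fun z => by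
    simp only [wulffSet, mem_iInter, mem_ofPred_eq]
  have hneg : ∀ v ∈ closure (Omega C), ⟪v, e 0⟫ * u (PhiInv e v) ≤ 0 := by
    intro v hv
    obtain ⟨x, hx, rfl⟩ := exists_eq_Phi_of_mem_closure_Omega he hv
    rw [PhiInv_Phi, inner_Phi_zero]
    exact mul_nonpos_of_nonneg_of_nonpos (by positivity) (hu0 x hx)
  have hne : (wulffSet C e u).Nonempty :=
    ⟨pt e (-conj (closure (domain C e)) u 0) 0, by
      rw [mem_wulffSet_iff hC he hu, inner_pt_zero, tail_pt]⟩
  refine ⟨⟨hne, isClosed_wulffSet, ?_, ?_⟩, ?_⟩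
  · intro x hx y hy a b ha hb hab
    rw [hmem] at hx hy ⊢
    intro v hv
    rw [inner_add_left, real_inner_smul_left, real_inner_smul_left]
    have h1 := mul_le_mul_of_nonneg_left (hx v hv) ha
    have h2 := mul_le_mul_of_nonneg_left (hy v hv) hb
    calc _ ≤ (a + b) * (⟪v, e 0⟫ * u (PhiInv e v)) := by linarith
      _ = _ := by rw [hab, one_mul]
  · intro x hx r hr
    rw [hmem] at hx ⊢
    intro v hv
    rw [real_inner_smul_left]
    nlinarith [hx v hv, hneg v hv]
  · ext y
    constructor
    · intro hy
      rw [← wulffSet_zero hC he]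
      simp only [wulffSet, mem_iInter, mem_ofPred_eq, Pi.zero_apply, mul_zero]
      intro v hv
      obtain ⟨z, hz⟩ := hne
      by_contra! hpos
      set b := ⟪v, e 0⟫ * u (PhiInv e v)
      -- This multiple of `y` would raise the pairing with `v` to at least `b + 1`.
      have h1 := (hmem _).1 (hy z hz (max 1 ((b - ⟪z, v⟫ + 1) / ⟪y, v⟫)) (le_max_left _ _)) v hv
      rw [inner_add_left, real_inner_smul_left] at h1
      have h2 := mul_le_mul_of_nonneg_right
        (le_max_right 1 ((b - ⟪z, v⟫ + 1) / ⟪y, v⟫)) hpos.le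
      rw [div_mul_cancel₀ _ hpos.ne'] at h2
      linarith
    · intro hy z hz r hr
      rw [hmem] at hz ⊢
      intro v hv
      rw [inner_add_left, real_inner_smul_left]
      have h1 : ⟪y, v⟫ ≤ 0 := (closure_Omega_subset hv).1 y hy
      nlinarith [hz v hv]

/-- The values of `u` at maximisers of `⟪p, ·⟫ - u` tend to zero as `p` tends to infinity. -/
theorem exists_neg_lt_of_conj_eq {D : Set (Euc m)} (hD : Bornology.IsBounded D)
    (hu : ContinuousOn u (closure D)) (hu0 : ∀ x ∈ closure D, u x ≤ 0)
    (hfr : ∀ x ∈ frontier D, u x = 0) {ε : ℝ} (hε : 0 < ε) :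
    ∃ T : ℝ, ∀ p x : Euc m, T < ‖p‖ → x ∈ closure D →
      conj (closure D) u p = ⟪p, x⟫ - u x → -u x < ε := by
  have hK := hD.isCompact_closure
  obtain ⟨M, hM⟩ := hK.exists_bound_of_continuousOn hu
  obtain ⟨δ, hδ, hδu⟩ := Metric.uniformContinuousOn_iff.1
    (hK.uniformContinuousOn_of_continuous hu) ε hε
  refine ⟨|M| / (δ / 2), fun p x hp hx hpx => ?_⟩
  have hp0 : 0 < ‖p‖ := lt_of_le_of_lt (by positivity) hp
  rw [div_lt_iff₀ (by positivity)] at hp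
  set h : Euc m := ‖p‖⁻¹ • p
  have hh : ‖h‖ = 1 := by simp [h, norm_smul, hp0.ne']
  -- A step of length `δ / 2` along `p` gains `‖p‖ δ / 2 > |M|` in the linear term, more than `u`
  -- can offset, contradicting maximality of `x`. So `∂D` is met within `δ / 2` of `x`.
  have hout : x + (δ / 2) • h ∉ closure D := by
    intro hmem
    have h1 := inner_sub_le_conj hK hu p hmem
    have h2 : ⟪p, h⟫ = ‖p‖ := by
      rw [real_inner_smul_right, real_inner_self_eq_norm_sq]
      field_simp
    rw [hpx, inner_add_right, real_inner_smul_right, h2] at h1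
    have h3 := hu0 _ hmem
    have h4 := hM x hx
    rw [Real.norm_eq_abs] at h4
    linarith [neg_le_abs (u x), le_abs_self M]
  have hpre : IsPreconnected ((fun t : ℝ => x + t • h) '' Icc 0 (δ / 2)) :=
    isPreconnected_Icc.image _ (by fun_prop)
  obtain ⟨_, ⟨t, ht, rfl⟩, hf⟩ := hpre.inter_frontier_nonempty (t := closure D)
    ⟨x, ⟨0, ⟨le_rfl, by positivity⟩, by simp⟩, hx⟩
    ⟨x + (δ / 2) • h, ⟨δ / 2, ⟨by positivity, le_rfl⟩, rfl⟩, hout⟩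
  have hfD := frontier_closure_subset hf
  have h1 := hδu x hx _ (frontier_subset_closure hfD) (by
    rw [dist_eq_norm, sub_add_cancel_left, norm_neg, norm_smul, hh, mul_one,
      Real.norm_of_nonneg ht.1]
    linarith [ht.2])
  simp only [hfr _ hfD, dist_zero_right, Real.norm_eq_abs] at h1
  exact (neg_le_abs _).trans_lt h1

theorem tendsto_infDist_frontier_wulffSet (hC : IsSolidPointedCone C) (he : IsAxis C (-e 0))
    (hu : ContinuousOn u (closure (domain C e))) (hu0 : ∀ x ∈ closure (domain C e), u x ≤ 0)
    (hfr : ∀ x ∈ frontier (domain C e), u x = 0) :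
    Tendsto (fun x : Euc (m + 1) => Metric.infDist x (frontier C))
      (Bornology.cobounded (Euc (m + 1)) ⊓ 𝓟 (frontier (wulffSet C e u))) (𝓝 0) := by
  have hK := isCompact_closure_domain he
  have hne : (closure (domain C e)).Nonempty := ⟨0, subset_closure (zero_mem_domain hC he)⟩
  have hc := continuous_conj hK hne hu
  rw [Metric.tendsto_nhds]
  intro ε hε
  obtain ⟨T, hT⟩ := exists_neg_lt_of_conj_eq (isBounded_domain he) hu hu0 hfr hε
  -- The conjugate is bounded over `‖p‖ ≤ T`, so boundary points of norm above `B + T` have `‖p‖ >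
  -- T`.
  obtain ⟨B, hB⟩ := (isCompact_closedBall (0 : Euc m) T).exists_bound_of_continuousOn
    hc.continuousOn
  rw [eventually_inf_principal]
  filter_upwards [Bornology.isBounded_def.1
    (Metric.isBounded_closedBall (x := (0 : Euc (m + 1))) (r := B + T))] with z hz hzK
  rw [mem_frontier_wulffSet_iff hC he hu] at hzK
  set p := tail e z with hp
  have hpT : T < ‖p‖ := by
    by_contra! h
    have h1 := hB p (by simpa using h)
    have h2 := norm_le_abs_add_norm_tail e z
    rw [hzK, abs_neg, ← hp] at h2
    simp only [mem_compl_iff, mem_closedBall_zero_iff, not_le] at hz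
    rw [Real.norm_eq_abs] at h1
    linarith
  obtain ⟨x, hx, hpx⟩ := exists_conj_eq hK hne hu p
  have hlt := hT p x hpT hx hpx
  have hcont0 : ContinuousOn (0 : Euc m → ℝ) (closure (domain C e)) := continuousOn_const
  have h0 := inner_sub_le_conj hK hcont0 p hx
  have h1 : conj (closure (domain C e)) 0 p ≤ conj (closure (domain C e)) u p := by
    rw [conj_le_iff hK hne hcont0]
    intro y hy
    have := inner_sub_le_conj hK hu p hy
    have := hu0 y hy
    simp only [Pi.zero_apply]
    linarith
  have hw : pt e (-conj (closure (domain C e)) 0 p) p ∈ frontier C := by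
    have := (mem_frontier_wulffSet_iff hC he hcont0
      (z := pt e (-conj (closure (domain C e)) 0 p) p)).2 (by rw [inner_pt_zero, tail_pt])
    rwa [wulffSet_zero hC he] at this
  -- The comparison point of `∂C` lies on the same vertical line, and `⟪p, x⟫ ≤ 0*(p) ≤ u*(p) = ⟪p,
  -- x⟫ - u x`.
  have hd : dist z (pt e (-conj (closure (domain C e)) 0 p) p) ≤ -u x := by
    rw [dist_eq_norm]
    conv_lhs => rw [← pt_tail e z, pt_sub, hzK, ← hp, sub_self, norm_pt_zero_right]
    simp only [Pi.zero_apply] at h0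
    rw [abs_le]
    constructor <;> linarith
  rw [dist_zero_right, Real.norm_of_nonneg Metric.infDist_nonneg]
  exact (Metric.infDist_le_dist_of_mem hw).trans_lt (hd.trans_lt hlt)

end Asymptotic

/-! ### Local comparison of measures and areas of nearly planar graphs -/

section Measure

/-- By second countability, countably many good neighbourhoods cover `A`; cut into disjoint pieces,
they let the inequalities be summed, with no finiteness needed. -/
theorem measure_le_of_locally_le {X : Type*} [TopologicalSpace X] [SecondCountableTopology X]
    [MeasurableSpace X] [OpensMeasurableSpace X] {μ ν : Measure X} {D : Set X}
    (h : ∀ x ∈ D, ∃ U ∈ 𝓝 x, ∀ A ⊆ U ∩ D, MeasurableSet A → μ A ≤ ν A) {A : Set X}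
    (hA : MeasurableSet A) (hAD : A ⊆ D) : μ A ≤ ν A := by
  rcases A.eq_empty_or_nonempty with rfl | hne
  · simp
  choose! U hU hUA using h
  obtain ⟨t, htA, htc, hcov⟩ := TopologicalSpace.countable_cover_nhdsWithin
    (f := fun x => interior (U x)) (s := A)
    fun x hx => mem_nhdsWithin_of_mem_nhds (interior_mem_nhds.2 (hU x (hAD hx)))
  have htne : t.Nonempty := by
    by_contra h
    simp [not_nonempty_iff_eq_empty.1 h, hne.ne_empty] at hcov
  obtain ⟨g, rfl⟩ := htc.exists_eq_range htne
  set V : ℕ → Set X := fun n => interior (U (g n))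
  have hV : A = ⋃ n, A ∩ disjointed V n := by
    rw [← inter_iUnion, iUnion_disjointed, left_eq_inter]
    simpa [V] using hcov
  have hmeas : ∀ n, MeasurableSet (A ∩ disjointed V n) := fun n =>
    hA.inter (MeasurableSet.disjointed (fun n => isOpen_interior.measurableSet) n)
  have hdisj : Pairwise (Function.onFun Disjoint fun n => A ∩ disjointed V n) :=
    fun i j hij => (disjoint_disjointed V hij).mono inter_subset_right inter_subset_right
  rw [hV, measure_iUnion hdisj hmeas, measure_iUnion hdisj hmeas]
  refine ENNReal.tsum_le_tsum fun n => hUA (g n) (hAD (htA ⟨n, rfl⟩)) _ ?_ (hmeas n)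
  exact fun x hx => ⟨interior_subset (disjointed_subset V n hx.2), hAD hx.1⟩

theorem le_of_forall_one_lt_le_mul {a b : ℝ≥0∞}
    (h : ∀ c : ℝ, 1 < c → a ≤ ENNReal.ofReal c * b) : a ≤ b := by
  have hlim : Tendsto (fun c : ℝ => ENNReal.ofReal c * b) (𝓝[>] 1) (𝓝 b) := by
    have h1 : Tendsto (fun c : ℝ => ENNReal.ofReal c) (𝓝[>] 1) (𝓝 1) := by
      have := (ENNReal.continuous_ofReal.tendsto 1).mono_left
        (nhdsWithin_le_nhds (s := Ioi (1 : ℝ)))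
      rwa [ENNReal.ofReal_one] at this
    simpa using ENNReal.Tendsto.mul_const h1 (Or.inl one_ne_zero)
  exact ge_of_tendsto hlim (eventually_mem_nhdsWithin.mono fun c hc => h c hc)

/-- If distances under `F` are at most `K` times distances under `B`, then the Hausdorff measures
of images compare accordingly. -/
theorem euclideanHausdorffMeasure_image_le {X Y Z : Type*} [MetricSpace Y] [MeasurableSpace Y]
    [BorelSpace Y] [MetricSpace Z] [MeasurableSpace Z] [BorelSpace Z] {F : X → Y} {B : X → Z}
    {P : Set X} {K : ℝ} (hK : 0 ≤ K)
    (h : ∀ p ∈ P, ∀ q ∈ P, dist (F p) (F q) ≤ K * dist (B p) (B q)) (d : ℕ) :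
    μHE[d] (F '' P) ≤ ENNReal.ofReal (K ^ d) * μHE[d] (B '' P) := by
  rcases P.eq_empty_or_nonempty with rfl | ⟨p₀, hp₀⟩
  · simp
  have : Nonempty X := ⟨p₀⟩
  set g := Function.invFunOn B P
  -- With `g` a chosen inverse of `B` on `P`, the map `F ∘ g` is `K`-Lipschitz on `B '' P`; the
  -- distance bound makes `F` independent of the choice.
  have hg : ∀ p ∈ P, g (B p) ∈ P ∧ B (g (B p)) = B p := fun p hp =>
    ⟨Function.invFunOn_mem ⟨p, hp, rfl⟩, Function.invFunOn_eq ⟨p, hp, rfl⟩⟩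
  have himg : F '' P = (F ∘ g) '' (B '' P) := by
    rw [image_image]
    refine image_congr fun p hp => ?_
    have := h p hp _ (hg p hp).1
    rw [(hg p hp).2, dist_self, mul_zero] at this
    exact dist_le_zero.1 this
  have hL : LipschitzOnWith K.toNNReal (F ∘ g) (B '' P) := by
    refine LipschitzOnWith.of_dist_le_mul ?_
    rintro _ ⟨p, hp, rfl⟩ _ ⟨q, hq, rfl⟩
    have := h _ (hg p hp).1 _ (hg q hq).1
    rwa [(hg p hp).2, (hg q hq).2, ← Real.coe_toNNReal K hK] at this
  have hH := hL.hausdorffMeasure_image_le (d := d) (by positivity)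
  rw [himg, Measure.euclideanHausdorffMeasure_def, Measure.euclideanHausdorffMeasure_def,
    Measure.smul_apply, Measure.smul_apply, mul_smul_comm, ENNReal.ofReal_pow hK]
  rw [ENNReal.rpow_natCast] at hH
  gcongr
  exact hH

variable {m : ℕ} (e : OrthonormalBasis (Fin (m + 1)) ℝ (Euc (m + 1)))

/-- A linear map of `ℝ^m` which is isometric to the linear embedding `h ↦ (-⟪a, h⟫, h)`. -/
def tilt (a : Euc m) : Euc m →ₗ[ℝ] Euc m :=
  LinearMap.transvection (innerₗ (Euc m) a) ((1 + √(1 + ‖a‖ ^ 2))⁻¹ • a)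

/-- With `s = √(1 + ‖a‖²)` the determinant is `1 + ‖a‖² / (1 + s)`, and `‖a‖² = (s - 1)(s + 1)`. -/
theorem det_tilt (a : Euc m) : LinearMap.det (tilt a) = √(1 + ‖a‖ ^ 2) := by
  have h := Real.sq_sqrt (show 0 ≤ 1 + ‖a‖ ^ 2 by positivity)
  have h0 : 1 + √(1 + ‖a‖ ^ 2) ≠ 0 := by positivity
  rw [tilt, LinearMap.transvection.det, map_smul, innerₗ_apply_apply, real_inner_self_eq_norm_sq,
    smul_eq_mul]
  field_simp
  linarith

theorem norm_tilt (a h : Euc m) : ‖tilt a h‖ = ‖pt e (-⟪a, h⟫) h‖ := by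
  have h1 := Real.sq_sqrt (show 0 ≤ 1 + ‖a‖ ^ 2 by positivity)
  have h0 : 1 + √(1 + ‖a‖ ^ 2) ≠ 0 := by positivity
  rw [← sq_eq_sq₀ (norm_nonneg _) (norm_nonneg _), norm_pt_sq, tilt,
    LinearMap.transvection.apply, innerₗ_apply_apply, norm_add_sq_real, smul_smul, norm_smul,
    real_inner_smul_right, real_inner_comm, mul_pow, Real.norm_eq_abs, sq_abs]
  have h2 : ‖a‖ ^ 2 = √(1 + ‖a‖ ^ 2) ^ 2 - 1 := by linarith
  generalize √(1 + ‖a‖ ^ 2) = s at h0 h2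
  rw [h2]
  field_simp
  ring

/-- The graph of `-f` and the plane of slope `-a` differ vertically by at most `δ ‖p - q‖`, and
`tilt a` realises planar distances, which dominate `‖p - q‖`. -/
theorem dist_pt_pt_of_tilt {f : Euc m → ℝ} {a p q : Euc m} {δ : ℝ}
    (h : |f p - f q - ⟪a, p - q⟫| ≤ δ * ‖p - q‖) :
    |dist (pt e (-f p) p) (pt e (-f q) q) - dist (tilt a p) (tilt a q)| ≤
      δ * dist (tilt a p) (tilt a q) := by
  have hle : ‖p - q‖ ≤ ‖tilt a (p - q)‖ := by
    rw [norm_tilt e, norm_pt]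
    exact Real.le_sqrt_of_sq_le (by nlinarith [sq_nonneg ⟪a, p - q⟫])
  rw [dist_eq_norm, dist_eq_norm, pt_sub, ← map_sub]
  have h1 : ‖pt e (-f p - -f q) (p - q)‖ - ‖tilt a (p - q)‖ =
      ‖pt e (-f p - -f q) (p - q)‖ - ‖pt e (-⟪a, p - q⟫) (p - q)‖ := by rw [norm_tilt e]
  have h2 := abs_norm_sub_norm_le (pt e (-f p - -f q) (p - q)) (pt e (-⟪a, p - q⟫) (p - q))
  rw [pt_sub, sub_self, norm_pt_zero_right] at h2
  have h3 : |-f p - -f q - -⟪a, p - q⟫| = |f p - f q - ⟪a, p - q⟫| := by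
    rw [← abs_neg]; congr 1; ring
  rw [h1]
  rcases le_or_gt 0 δ with hδ | hδ
  · rw [h3] at h2
    exact h2.trans (h.trans (mul_le_mul_of_nonneg_left hle hδ))
  · have h4 : ‖p - q‖ = 0 := by
      by_contra hne
      have := (norm_nonneg (p - q)).lt_of_ne' hne
      have := (abs_nonneg _).trans h
      nlinarith
    have h5 : p - q = 0 := norm_eq_zero.1 h4
    have h6 : |f p - f q - ⟪a, p - q⟫| ≤ 0 := by simpa [h4] using h
    rw [h3] at h2
    refine (h2.trans h6).trans ?_
    simp [h5]

theorem volume_image_tilt (a : Euc m) (P : Set (Euc m)) :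
    (μHE[m] : Measure (Euc m)) (tilt a '' P) = ENNReal.ofReal √(1 + ‖a‖ ^ 2) * μHE[m] P := by
  rw [EuclideanSpace.euclideanHausdorffMeasure_eq_volume, Measure.addHaar_image_linearMap,
    det_tilt, abs_of_nonneg (Real.sqrt_nonneg _)]

/-- Almost planar graphs have almost the area of a planar graph. -/
theorem euclideanHausdorffMeasure_graph_le {f : Euc m → ℝ} {a : Euc m} {P : Set (Euc m)} {δ : ℝ}
    (hδ : 0 ≤ δ) (h : ∀ p ∈ P, ∀ q ∈ P, |f p - f q - ⟪a, p - q⟫| ≤ δ * ‖p - q‖) :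
    μHE[m] ((fun p => pt e (-f p) p) '' P) ≤
      ENNReal.ofReal ((1 + δ) ^ m) * (ENNReal.ofReal √(1 + ‖a‖ ^ 2) * μHE[m] P) := by
  rw [← volume_image_tilt]
  refine euclideanHausdorffMeasure_image_le (by positivity) (fun p hp q hq => ?_) m
  have := (abs_le.1 (dist_pt_pt_of_tilt e (h p hp q hq))).2
  linarith

theorem le_euclideanHausdorffMeasure_graph {f : Euc m → ℝ} {a : Euc m} {P : Set (Euc m)} {δ : ℝ}
    (hδ : δ < 1) (h : ∀ p ∈ P, ∀ q ∈ P, |f p - f q - ⟪a, p - q⟫| ≤ δ * ‖p - q‖) :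
    ENNReal.ofReal √(1 + ‖a‖ ^ 2) * μHE[m] P ≤
      ENNReal.ofReal ((1 - δ)⁻¹ ^ m) * μHE[m] ((fun p => pt e (-f p) p) '' P) := by
  rw [← volume_image_tilt]
  have hδ' : 0 < 1 - δ := by linarith
  refine euclideanHausdorffMeasure_image_le (by positivity) (fun p hp q hq => ?_) m
  have := (abs_le.1 (dist_pt_pt_of_tilt e (h p hp q hq))).1
  rw [inv_mul_eq_div, le_div_iff₀ hδ']
  linarith

end Measure

/-! ### The surface area measure of `K` -/

section SurfaceArea

variable {m : ℕ} {C : Set (Euc (m + 1))} (e : OrthonormalBasis (Fin (m + 1)) ℝ (Euc (m + 1)))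
  {u f : Euc m → ℝ}

/-- The upper bound is a defining inequality of `K`; the lower one is `u** = u`, tested at points of
the graph of `-u*`. -/
theorem supportFn_wulffSet_Phi {e : OrthonormalBasis (Fin (m + 1)) ℝ (Euc (m + 1))}
    (hC : IsSolidPointedCone C) (he : IsAxis C (-e 0))
    (hu : ContinuousOn u (closure (domain C e))) (hc : ConvexOn ℝ (closure (domain C e)) u)
    {x : Euc m} (hx : x ∈ closure (domain C e)) :
    supportFn (wulffSet C e u) (Phi e x) = (√(1 + ‖x‖ ^ 2))⁻¹ * u x := by
  have hK := isCompact_closure_domain he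
  have hs := sqrt_one_add_pos x
  have hpt : ∀ p, pt e (-conj (closure (domain C e)) u p) p ∈ wulffSet C e u := fun p => by
    rw [mem_wulffSet_iff hC he hu, inner_pt_zero, tail_pt]
  have hub : ∀ y ∈ (fun z : Euc (m + 1) => ⟪z, Phi e x⟫) '' wulffSet C e u,
      y ≤ (√(1 + ‖x‖ ^ 2))⁻¹ * u x := by
    rintro _ ⟨z, hz, rfl⟩
    have := (mem_wulffSet_iff_tail he).1 hz x hx
    simp only
    rw [← pt_tail e z, inner_pt_Phi]
    gcongr
  refine le_antisymm (csSup_le ⟨_, mem_image_of_mem _ (hpt 0)⟩ hub) ?_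
  refine le_of_forall_lt fun a ha => ?_
  rw [inv_mul_eq_div, lt_div_iff₀ hs] at ha
  obtain ⟨b, hab, hb⟩ := exists_between ha
  obtain ⟨p, hp⟩ := exists_lt_inner_sub_conj hK hu hc hx hb
  refine lt_of_lt_of_le ?_ (le_csSup ⟨_, hub⟩ (mem_image_of_mem _ (hpt p)))
  rw [inner_pt_Phi, inv_mul_eq_div, lt_div_iff₀ hs]
  linarith

theorem invGauss_wulffSet {e : OrthonormalBasis (Fin (m + 1)) ℝ (Euc (m + 1))}
    (hC : IsSolidPointedCone C) (he : IsAxis C (-e 0))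
    (hu : ContinuousOn u (closure (domain C e))) (hc : ConvexOn ℝ (closure (domain C e)) u)
    {Ξ : Set (Euc m)} (hΞ : Ξ ⊆ domain C e) :
    invGauss (wulffSet C e u) (Phi e '' Ξ) =
      (fun p => pt e (-conj (closure (domain C e)) u p) p) '' ⋃ x ∈ Ξ, subdiff (domain C e) u x := by
  have hK := isCompact_closure_domain he
  have key : ∀ x ∈ Ξ, ∀ p, ⟪pt e (-conj (closure (domain C e)) u p) p, Phi e x⟫ =
      supportFn (wulffSet C e u) (Phi e x) ↔ p ∈ subdiff (domain C e) u x := by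
    intro x hx p
    rw [supportFn_wulffSet_Phi hC he hu hc (subset_closure (hΞ hx)), inner_pt_Phi,
      mem_subdiff_iff hK hu (hΞ hx), mul_right_inj' (inv_pos.2 (sqrt_one_add_pos x)).ne']
    constructor <;> intro <;> linarith
  ext z
  constructor
  · rintro ⟨hz, _, ⟨x, hx, rfl⟩, hzx⟩
    rw [mem_frontier_wulffSet_iff hC he hu] at hz
    have hz' : pt e (-conj (closure (domain C e)) u (tail e z)) (tail e z) = z := by
      rw [← hz, pt_tail]
    refine ⟨tail e z, mem_iUnion₂.2 ⟨x, hx, (key x hx _).1 ?_⟩, hz'⟩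
    rw [hz', hzx]
  · rintro ⟨p, hp, rfl⟩
    obtain ⟨x, hx, hpx⟩ := mem_iUnion₂.1 hp
    refine ⟨?_, _, ⟨x, hx, rfl⟩, (key x hx p).2 hpx⟩
    rw [mem_frontier_wulffSet_iff hC he hu, inner_pt_zero, tail_pt]

theorem continuous_graph (hf : Continuous f) : Continuous fun p => pt e (-f p) p := by fun_prop

theorem measurableEmbedding_graph (hf : Continuous f) :
    MeasurableEmbedding fun p => pt e (-f p) p :=
  (continuous_graph e hf).measurableEmbedding fun p q h => by
    simpa using congrArg (tail e) h

theorem euclideanHausdorffMeasure_graph_null {L : NNReal} (hf : LipschitzWith L f)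
    {N : Set (Euc m)} (hN : (μHE[m] : Measure (Euc m)) N = 0) :
    μHE[m] ((fun p => pt e (-f p) p) '' N) = 0 := by
  -- A crude use with slope `0` and error equal to the Lipschitz constant; only finiteness of the
  -- factor matters.
  have := euclideanHausdorffMeasure_graph_le e (f := f) (a := 0) (P := N) L.coe_nonneg
    fun p _ q _ => by
      rw [inner_zero_left, sub_zero, ← Real.dist_eq, ← dist_eq_norm]
      exact hf.dist_le_mul p q
  rw [hN, mul_zero, mul_zero] at this
  exact le_antisymm this bot_le

/-- The area of the graph of `-f`, as a measure of the set of gradients of `f`. -/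
def gradientArea (f : Euc m → ℝ) : Measure (Euc m) :=
  ((Measure.comap (fun p => pt e (-f p) p) μHE[m]).restrict
    {p | DifferentiableAt ℝ f p}).map (gradient f)

/-- Shows that the graph area over `∂u(Ξ)` is countably additive in `Ξ`. Where `u*` is
differentiable, `p ∈ ∂u(Ξ)` means `∇u*(p) ∈ Ξ`; by Rademacher the remaining `p` are null, and so is
the graph above them. -/
theorem gradientArea_conj_apply {D : Set (Euc m)} (hD : Bornology.IsBounded D)
    (hne : D.Nonempty) (hu : ContinuousOn u (closure D)) {Ξ : Set (Euc m)} (hΞ : MeasurableSet Ξ)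
    (hΞD : Ξ ⊆ D) :
    gradientArea e (conj (closure D) u) Ξ =
      μHE[m] ((fun p => pt e (-conj (closure D) u p) p) '' ⋃ x ∈ Ξ, subdiff D u x) := by
  have hK := hD.isCompact_closure
  obtain ⟨L, hL⟩ := exists_lipschitzWith_conj hK hne.closure hu
  set f := conj (closure D) u
  set P := ⋃ x ∈ Ξ, subdiff D u x
  have hmd : MeasurableSet {p | DifferentiableAt ℝ f p} := measurableSet_of_differentiableAt ℝ f
  have hP : gradient f ⁻¹' Ξ ∩ {p | DifferentiableAt ℝ f p} =
      P ∩ {p | DifferentiableAt ℝ f p} := by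
    ext p
    refine and_congr_left fun hp => ?_
    constructor
    · intro hpΞ
      obtain ⟨x, hx, hpx⟩ := exists_conj_eq hK hne.closure hu p
      have hgx := gradient_conj_eq hK hu hx hpx hp
      rw [mem_preimage, hgx] at hpΞ
      exact mem_iUnion₂.2 ⟨x, hpΞ, (mem_subdiff_iff hK hu (hΞD hpΞ)).2 hpx⟩
    · intro hpP
      obtain ⟨x, hx, hpx⟩ := mem_iUnion₂.1 hpP
      rw [mem_subdiff_iff hK hu (hΞD hx)] at hpx
      rw [mem_preimage, gradient_conj_eq hK hu (subset_closure (hΞD hx)) hpx hp]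
      exact hx
  have hnull : μHE[m] ((fun p => pt e (-f p) p) '' {p | DifferentiableAt ℝ f p}ᶜ) = 0 := by
    refine euclideanHausdorffMeasure_graph_null e hL ?_
    rw [EuclideanSpace.euclideanHausdorffMeasure_eq_volume]
    exact hL.ae_differentiableAt
  rw [gradientArea, Measure.map_apply (measurable_gradient f) hΞ,
    Measure.restrict_apply (measurable_gradient f hΞ),
    (measurableEmbedding_graph e hL.continuous).comap_apply, hP]
  refine le_antisymm (measure_mono (image_mono inter_subset_left)) ?_
  calc _ ≤ μHE[m] ((fun p => pt e (-f p) p) '' (P ∩ {p | DifferentiableAt ℝ f p}) ∪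
        (fun p => pt e (-f p) p) '' {p | DifferentiableAt ℝ f p}ᶜ) := by
        rw [← image_union]
        refine measure_mono (image_mono fun p hp => ?_)
        by_cases h : DifferentiableAt ℝ f p
        · exact Or.inl ⟨hp, h⟩
        · exact Or.inr h
    _ ≤ _ := measure_union_le _ _
    _ = _ := by rw [hnull, add_zero]

/-- The conjugate is almost affine on the image of a small set under the subdifferential. -/
theorem abs_conj_sub_conj_sub_inner_le {D : Set (Euc m)} (hD : Bornology.IsBounded D)
    (hu : ContinuousOn u (closure D)) {Ξ : Set (Euc m)} (hΞD : Ξ ⊆ D) {a : Euc m} {δ : ℝ}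
    (hΞ : Ξ ⊆ Metric.ball a δ) :
    ∀ p ∈ ⋃ x ∈ Ξ, subdiff D u x, ∀ q ∈ ⋃ x ∈ Ξ, subdiff D u x,
      |conj (closure D) u p - conj (closure D) u q - ⟪a, p - q⟫| ≤ δ * ‖p - q‖ := by
  have hK := hD.isCompact_closure
  have key : ∀ p ∈ ⋃ x ∈ Ξ, subdiff D u x, ∀ q,
      conj (closure D) u p - conj (closure D) u q - ⟪a, p - q⟫ ≤ δ * ‖p - q‖ := by
    intro p hp q
    obtain ⟨x, hx, hpx⟩ := mem_iUnion₂.1 hp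
    rw [mem_subdiff_iff hK hu (hΞD hx)] at hpx
    have h1 := conj_sub_le hK hu (subset_closure (hΞD hx)) hpx q
    have h2 := real_inner_le_norm (x - a) (p - q)
    have h3 : ‖x - a‖ * ‖p - q‖ ≤ δ * ‖p - q‖ := by
      gcongr
      exact (mem_ball_iff_norm.1 (hΞ hx)).le
    rw [inner_sub_left, real_inner_comm (p - q) x] at h2
    linarith
  intro p hp q hq
  refine abs_le.2 ⟨?_, key p hp q⟩
  have := key q hq p
  rw [← neg_sub p q, inner_neg_right, norm_neg] at this
  linarith

theorem measurable_PhiInv : Measurable fun v : Omega C => PhiInv e (v : Euc (m + 1)) := by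
  have h1 : Measurable fun v : Euc (m + 1) => PhiInv e v := by
    have h2 : Measurable fun v : Euc (m + 1) => ⟪v, e 0⟫ :=
      Continuous.measurable (by fun_prop)
    exact h2.inv.smul (continuous_tail e).measurable
  exact h1.comp measurable_subtype_coe

variable {e}

theorem setOf_mem_Phi_image (he : IsAxis C (-e 0)) (Ξ : Set (Euc m)) :
    {v : Omega C | (v : Euc (m + 1)) ∈ Phi e '' Ξ} =
      (fun v : Omega C => PhiInv e (v : Euc (m + 1))) ⁻¹' Ξ := by
  ext v
  have h1 : ‖(v : Euc (m + 1))‖ = 1 := by simpa using v.2.2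
  constructor
  · rintro ⟨x, hx, hxv⟩
    rw [mem_preimage, ← hxv, PhiInv_Phi]
    exact hx
  · exact fun h => ⟨_, h, Phi_PhiInv e h1
      (inner_zero_pos_of_mem_dualCone he (interior_subset v.2.1) h1)⟩

/-- On small sets the transported measure is almost a multiple of the image measure. -/
theorem transported_bounds (he : IsAxis C (-e 0)) (μ : Measure (Omega C)) {a : Euc m} {c : ℝ}
    (hc : 1 < c) : ∃ U ∈ 𝓝 a, ∀ Ξ ⊆ U, MeasurableSet Ξ →
      ENNReal.ofReal √(1 + ‖a‖ ^ 2) * transported e μ Ξ ≤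
        ENNReal.ofReal c * μ.map (fun v : Omega C => PhiInv e (v : Euc (m + 1))) Ξ ∧
      μ.map (fun v : Omega C => PhiInv e (v : Euc (m + 1))) Ξ ≤
        ENNReal.ofReal c * (ENNReal.ofReal √(1 + ‖a‖ ^ 2) * transported e μ Ξ) := by
  set s := √(1 + ‖a‖ ^ 2) with hs
  have hs0 : 0 < s := sqrt_one_add_pos a
  have hcont : Continuous fun x : Euc m => s * ⟪Phi e x, e 0⟫ := by
    have := continuous_Phi e
    fun_prop
  have hat : s * ⟪Phi e a, e 0⟫ = 1 := by rw [inner_Phi_zero, mul_inv_cancel₀ hs0.ne']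
  have hc0 : 0 < c := by linarith
  -- The rescaled density equals `1` at `a`, so it stays between `c⁻¹` and `c` nearby.
  have hU : ∀ᶠ x in 𝓝 a, s * ⟪Phi e x, e 0⟫ ∈ Ioo c⁻¹ c :=
    hcont.tendsto a (Ioo_mem_nhds (hat ▸ inv_lt_one_of_one_lt₀ hc) (hat ▸ hc))
  refine ⟨_, hU, fun Ξ hΞ hm => ?_⟩
  have hmeas := measurable_PhiInv e (C := C) hm
  rw [transported, setOf_mem_Phi_image he, Measure.map_apply (measurable_PhiInv e) hm,
    ← lintegral_const_mul' _ _ ENNReal.ofReal_ne_top,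
    ← lintegral_const_mul' _ _ ENNReal.ofReal_ne_top]
  have hb : ∀ v ∈ (fun v : Omega C => PhiInv e (v : Euc (m + 1))) ⁻¹' Ξ,
      s * |⟪(v : Euc (m + 1)), e 0⟫| ∈ Ioo c⁻¹ c := by
    intro v hv
    obtain ⟨x, hx, hxv⟩ : (v : Euc (m + 1)) ∈ Phi e '' Ξ := by
      rw [← setOf_mem_Phi_image he] at hv
      exact hv
    rw [← hxv, abs_of_nonneg (by rw [inner_Phi_zero]; positivity)]
    exact hΞ hx
  constructor
  · rw [← setLIntegral_const]
    refine setLIntegral_mono' hmeas fun v hv => ?_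
    rw [← ENNReal.ofReal_mul hs0.le]
    exact ENNReal.ofReal_le_ofReal (hb v hv).2.le
  · rw [← setLIntegral_one]
    refine setLIntegral_mono' hmeas fun v hv => ?_
    rw [← ENNReal.ofReal_mul hs0.le, ← ENNReal.ofReal_mul hc0.le, ENNReal.one_le_ofReal]
    have := mul_le_mul_of_nonneg_left (hb v hv).1.le hc0.le
    rwa [mul_inv_cancel₀ hc0.ne'] at this

theorem exists_delta_pow_le (m : ℕ) {c : ℝ} (hc : 1 < c) :
    ∃ δ : ℝ, 0 < δ ∧ δ < 1 ∧ (1 + δ) ^ m ≤ c ∧ (1 - δ)⁻¹ ^ m ≤ c := by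
  have h1 : ContinuousAt (fun δ : ℝ => (1 + δ) ^ m) 0 := by fun_prop
  have h2 : ContinuousAt (fun δ : ℝ => (1 - δ)⁻¹ ^ m) 0 := by
    fun_prop (disch := norm_num)
  have h1' := h1.eventually (gt_mem_nhds (show (1 + (0 : ℝ)) ^ m < c by simpa))
  have h2' := h2.eventually (gt_mem_nhds (show (1 - (0 : ℝ))⁻¹ ^ m < c by simpa))
  obtain ⟨δ, ⟨⟨ha, hb⟩, hδ1⟩, hδ0⟩ := ((((h1'.and h2').and
    (gt_mem_nhds (zero_lt_one' ℝ))).filter_mono nhdsWithin_le_nhds).and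
    (self_mem_nhdsWithin (a := (0 : ℝ)) (s := Ioi 0))).exists
  exact ⟨δ, hδ0, hδ1, ha.le, hb.le⟩

theorem gradientArea_eq_map (hC : IsSolidPointedCone C) (he : IsAxis C (-e 0))
    (μ : Measure (Omega C)) (hu : ContinuousOn u (closure (domain C e)))
    (hu_eq : ∀ Ξ : Set (Euc m), MeasurableSet Ξ → Ξ ⊆ domain C e →
      mongeAmpere (domain C e) u Ξ = transported e μ Ξ) {Ξ : Set (Euc m)}
    (hΞ : MeasurableSet Ξ) (hΞD : Ξ ⊆ domain C e) :
    gradientArea e (conj (closure (domain C e)) u) Ξ =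
      μ.map (fun v : Omega C => PhiInv e (v : Euc (m + 1))) Ξ := by
  have hD := isBounded_domain he
  have hne : (domain C e).Nonempty := ⟨0, zero_mem_domain hC he⟩
  set ρ := gradientArea e (conj (closure (domain C e)) u)
  set ν := μ.map (fun v : Omega C => PhiInv e (v : Euc (m + 1)))
  -- One factor `c` accounts for the graph not being planar, the other for the variation of the
  -- density.
  have key : ∀ c : ℝ, 1 < c → ∀ a : Euc m, ∃ U ∈ 𝓝 a, ∀ A ⊆ U ∩ domain C e, MeasurableSet A →
      ρ A ≤ ENNReal.ofReal c * (ENNReal.ofReal c * ν A) ∧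
        ν A ≤ ENNReal.ofReal c * (ENNReal.ofReal c * ρ A) := by
    intro c hc a
    obtain ⟨U, hU, hUA⟩ := transported_bounds he μ (a := a) hc
    obtain ⟨δ, hδ0, hδ1, hδa, hδb⟩ := exists_delta_pow_le m hc
    refine ⟨U ∩ Metric.ball a δ, inter_mem hU (Metric.ball_mem_nhds a hδ0), fun A hA hAm => ?_⟩
    have hAD : A ⊆ domain C e := fun x hx => (hA hx).2
    have hgraph := abs_conj_sub_conj_sub_inner_le hD hu hAD (fun x hx => (hA hx).1.2)
    have h1 := euclideanHausdorffMeasure_graph_le e hδ0.le hgraph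
    have h2 := le_euclideanHausdorffMeasure_graph e hδ1 hgraph
    obtain ⟨h3, h4⟩ := hUA A (fun x hx => (hA hx).1.1) hAm
    rw [← gradientArea_conj_apply e hD hne hu hAm hAD] at h1 h2
    rw [← hu_eq A hAm hAD, mongeAmpere] at h3 h4
    constructor
    · exact h1.trans (mul_le_mul' (ENNReal.ofReal_le_ofReal hδa) h3)
    · exact h4.trans (mul_le_mul' le_rfl
        (h2.trans (mul_le_mul' (ENNReal.ofReal_le_ofReal hδb) le_rfl)))
  have hle : ∀ α β : Measure (Euc m), (∀ c : ℝ, 1 < c → ∀ a : Euc m, ∃ U ∈ 𝓝 a,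
      ∀ A ⊆ U ∩ domain C e, MeasurableSet A →
        α A ≤ ENNReal.ofReal c * (ENNReal.ofReal c * β A)) → α Ξ ≤ β Ξ := by
    intro α β h
    refine le_of_forall_one_lt_le_mul fun c hc => ?_
    have h1 : 1 < √c := Real.lt_sqrt_of_sq_lt (by simpa)
    have := measure_le_of_locally_le (μ := α) (D := domain C e)
      (ν := ENNReal.ofReal √c • (ENNReal.ofReal √c • β)) (fun a _ => h _ h1 a) hΞ hΞD
    rwa [Measure.smul_apply, Measure.smul_apply, smul_eq_mul, smul_eq_mul, ← mul_assoc,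
      ← ENNReal.ofReal_mul (Real.sqrt_nonneg c), Real.mul_self_sqrt (by linarith)] at this
  refine le_antisymm (hle _ _ fun c hc a => ?_) (hle _ _ fun c hc a => ?_)
  · exact (key c hc a).imp fun U hU => ⟨hU.1, fun A hA hAm => (hU.2 A hA hAm).1⟩
  · exact (key c hc a).imp fun U hU => ⟨hU.1, fun A hA hAm => (hU.2 A hA hAm).2⟩

theorem measurableSet_Omega {d : ℕ} (C : Set (Euc d)) : MeasurableSet (Omega C) :=
  isOpen_interior.measurableSet.inter Metric.isClosed_sphere.measurableSet

theorem surfaceArea_wulffSet (hC : IsSolidPointedCone C) (he : IsAxis C (-e 0))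
    (μ : Measure (Omega C)) (hu : ContinuousOn u (closure (domain C e)))
    (hc : ConvexOn ℝ (closure (domain C e)) u)
    (hu_eq : ∀ Ξ : Set (Euc m), MeasurableSet Ξ → Ξ ⊆ domain C e →
      mongeAmpere (domain C e) u Ξ = transported e μ Ξ) {η : Set (Omega C)}
    (hη : MeasurableSet η) : surfaceArea C (wulffSet C e u) η = μ η := by
  set Ξ : Set (Euc m) := Phi e ⁻¹' (Subtype.val '' η)
  have hΞ : MeasurableSet Ξ :=
    (continuous_Phi e).measurable ((measurableSet_Omega C).subtype_image hη)
  have hΞD : Ξ ⊆ domain C e := by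
    rintro x ⟨v, -, hv⟩
    rw [domain, mem_preimage, ← hv]
    exact v.2
  have himg : Phi e '' Ξ = Subtype.val '' η := by
    refine image_preimage_eq_of_subset ?_
    rintro _ ⟨v, -, rfl⟩
    have h1 : ‖(v : Euc (m + 1))‖ = 1 := by simpa using v.2.2
    exact ⟨_, Phi_PhiInv e h1 (inner_zero_pos_of_mem_dualCone he (interior_subset v.2.1) h1)⟩
  have hpre : (fun v : Omega C => PhiInv e (v : Euc (m + 1))) ⁻¹' Ξ = η := by
    rw [← setOf_mem_Phi_image he, himg]
    ext v
    simp
  rw [surfaceArea, ← himg, invGauss_wulffSet hC he hu hc hΞD,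
    ← gradientArea_conj_apply e (isBounded_domain he) ⟨0, zero_mem_domain hC he⟩ hu hΞ hΞD,
    gradientArea_eq_map hC he μ hu hu_eq hΞ hΞD, Measure.map_apply (measurable_PhiInv e) hΞ, hpre]

end SurfaceArea

end PseudoCone

end

theorem theorem3p3 (m : ℕ) (hm : 1 ≤ m)
    (C : Set (PseudoCone.Euc (m + 1))) (hC : PseudoCone.IsSolidPointedCone C)
    (e : OrthonormalBasis (Fin (m + 1)) ℝ (PseudoCone.Euc (m + 1)))
    (he : PseudoCone.IsAxis C (-e 0))
    (μ : Measure (PseudoCone.Omega C)) (hμ : IsLocallyFiniteMeasure μ)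
    (u : PseudoCone.Euc m → ℝ)
    (hu_cont : ContinuousOn u (closure (PseudoCone.domain C e)))
    (hu_conv : ConvexOn ℝ (closure (PseudoCone.domain C e)) u)
    (hu_eq : ∀ Ξ : Set (PseudoCone.Euc m), MeasurableSet Ξ → Ξ ⊆ PseudoCone.domain C e →
      PseudoCone.mongeAmpere (PseudoCone.domain C e) u Ξ = PseudoCone.transported e μ Ξ)
    (hu_bdry : ∀ x ∈ frontier (PseudoCone.domain C e), u x = 0) :
    PseudoCone.IsCAsymptotic C (PseudoCone.wulffSet C e u) ∧
      ∀ η : Set (PseudoCone.Omega C), MeasurableSet η →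
        PseudoCone.surfaceArea C (PseudoCone.wulffSet C e u) η = μ η := by
  have hu0 := PseudoCone.nonpos_of_frontier_eq_zero hm (PseudoCone.isBounded_domain he) hu_conv
    hu_bdry
  exact ⟨⟨PseudoCone.isCPseudo_wulffSet hC he hu_cont hu0,
    PseudoCone.tendsto_infDist_frontier_wulffSet hC he hu_cont hu0 hu_bdry⟩,
    fun η hη => PseudoCone.surfaceArea_wulffSet hC he μ hu_cont hu_conv hu_eq hη⟩
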